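/- Let $\mathbb T=\mathbb R/\mathbb Z$, let $\|\cdot\|$ be the norm of the real space $L^2(\mathbb T)$, and define the real Hilbert spaces $$\mathcal H_0=\Big\{f\in L^2(\mathbb T):\int_0^1 f\,dx=0\Big\},\qquad \mathcal H_1=\Big\{q\in \mathcal H_0: q'\in L^2(\mathbb T)\Big\},$$ where $q'$ is the weak derivative on $\mathbb T$, with the norms $\|f\|_{\mathcal H_0}=\|f\|$ and $\|q\|_{\mathcal H_1}=\|q'\|$. A bijection between real Hilbert spaces is a real analytic isomorphism if both it and its inverse are real analytic. Let $m\ge 1$ be an integer. For $q\in\mathcal H_1$ put $v=2q$ and $$\mathcal E=-v'-\frac{v^2}{m},\qquad \mathcal E_0=\int_0^1\mathcal E\,dx,\qquad \mathcal E_1=-v'-\frac{v^2}{m}+\frac1m\int_0^1v^2\,dx .$$ ($\mathcal E$ is the eigenvalue in the direction $dx$ of the Ricci tensor of the warped product metric $dx^2+r(x)^2g_Y$, where $\dim Y=m$ and $r(x)=r_0\exp\big(\tfrac2m\int_0^xq\,dt\big)$.) **Corollary.** For every $q\in\mathcal H_1$ we have $\mathcal E_0=-\frac1m\|v\|^2$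 and $\mathcal E=\mathcal E_0+\mathcal E_1$. The mapping $q\mapsto\mathcal E_1$ is a real analytic isomorphism between $\mathcal H_1$ and $\mathcal H_0$, and for all $q\in\mathcal H_1$ $$\|v'\|^2\le\|\mathcal E_1\|^2\le\|v'\|^2+\frac{\|v\|^2\|v'\|^2}{m^2}-\frac{\|v\|^4}{m^2}.$$ Moreover, $\mathcal E_0$ is uniquely determined by $\mathcal E_1$: it is a function of $\mathcal E_1$, and for every $F\in\mathcal H_0$ there is exactly one pair $(q,e)\in\mathcal H_1\times\mathbb R$ with $-v'-\frac{v^2}{m}=e+F$ almost everywhere, where $v=2q$. In particular, if $m=1$, then for every $r_0>0$ and every $G_1\in\mathcal H_0$ there is exactly one pair $(r,G_0)$, consisting of a profile $r(x)=r_0\exp\big(2\int_0^xq\,dt\big)$ with $q\in\mathcal H_1$ and a constant $G_0\in\mathbb R$, such that the Gaussian curvature of the metric $dx^2+r(x)^2dy^2$ equals $G_0+G_1(x)$ for almost every $x$ and all $y$. -/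

import Mathlib

open MeasureTheory

noncomputable section

namespace PerturbedTorus

/-- Real `L²(𝕋)`, where `𝕋 = ℝ/ℤ` carries Lebesgue (Haar) measure of total mass `1`. -/
abbrev L2T : Type := Lp ℝ 2 (volume : Measure UnitAddCircle)

/-- The function on `ℝ` (1-periodic) obtained by lifting an element of `L²(𝕋)`. -/
def lift (f : L2T) (x : ℝ) : ℝ := f (x : UnitAddCircle)

/-- `g ∈ L²(𝕋)` is the weak derivative of `f ∈ L²(𝕋)`: for all smooth 1-periodic `φ`,
`∫₀¹ f φ' = - ∫₀¹ g φ`. -/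
def HasWeakDeriv (f g : L2T) : Prop :=
  ∀ φ : ℝ → ℝ, ContDiff ℝ (⊤ : ℕ∞) φ → Function.Periodic φ 1 →
    ∫ x in (0 : ℝ)..1, lift f x * deriv φ x = - ∫ x in (0 : ℝ)..1, lift g x * φ x

theorem memLp_lift (f : L2T) : MemLp (lift f) 2 (volume.restrict (Set.Ioc (0 : ℝ) 1)) := by
  have h := (Lp.memLp f).comp_measurePreserving (UnitAddCircle.measurePreserving_mk 0)
  rw [zero_add] at h
  exact h

theorem intervalIntegrable_lift (f : L2T) : IntervalIntegrable (lift f) volume 0 1 := by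
  rw [intervalIntegrable_iff_integrableOn_Ioc_of_le zero_le_one]
  exact (memLp_lift f).integrable (by norm_num)

theorem intervalIntegrable_lift_mul (f : L2T) {φ : ℝ → ℝ} (hφ : Continuous φ) :
    IntervalIntegrable (fun x => lift f x * φ x) volume 0 1 :=
  (intervalIntegrable_lift f).mul_continuousOn hφ.continuousOn

theorem integral_lift (f : L2T) : ∫ x in (0 : ℝ)..1, lift f x = ∫ x, f x := by
  have h := UnitAddCircle.intervalIntegral_preimage 0 (f : UnitAddCircle → ℝ)
  rw [zero_add] at h
  exact h

theorem ae_lift {P : ℝ → UnitAddCircle → Prop} {Q : UnitAddCircle → Prop}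
    (h : ∀ᵐ x, Q x) (hQ : ∀ x : ℝ, Q x → P x x) :
    ∀ᵐ x ∂(volume.restrict (Set.Ioc (0 : ℝ) 1)), P x x := by
  have h1 := (UnitAddCircle.measurePreserving_mk 0).quasiMeasurePreserving.ae h
  rw [zero_add] at h1
  filter_upwards [h1] with x hx using hQ x hx

theorem integral_lift_add (f g : L2T) {φ : ℝ → ℝ} (hφ : Continuous φ) :
    ∫ x in (0 : ℝ)..1, lift (f + g) x * φ x =
      (∫ x in (0 : ℝ)..1, lift f x * φ x) + ∫ x in (0 : ℝ)..1, lift g x * φ x := by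
  rw [← intervalIntegral.integral_add (intervalIntegrable_lift_mul f hφ)
    (intervalIntegrable_lift_mul g hφ), intervalIntegral.integral_of_le zero_le_one,
    intervalIntegral.integral_of_le zero_le_one]
  refine integral_congr_ae (ae_lift (P := fun x _ => lift (f + g) x * φ x
    = lift f x * φ x + lift g x * φ x) (Lp.coeFn_add f g) ?_)
  intro x hx
  simp only [lift, hx, Pi.add_apply]
  ring

theorem integral_lift_smul (c : ℝ) (f : L2T) (φ : ℝ → ℝ) :
    ∫ x in (0 : ℝ)..1, lift (c • f) x * φ x = c * ∫ x in (0 : ℝ)..1, lift f x * φ x := by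
  rw [← intervalIntegral.integral_const_mul, intervalIntegral.integral_of_le zero_le_one,
    intervalIntegral.integral_of_le zero_le_one]
  refine integral_congr_ae (ae_lift (P := fun x _ => lift (c • f) x * φ x
    = c * (lift f x * φ x)) (Lp.coeFn_smul c f) ?_)
  intro x hx
  simp only [lift, hx, Pi.smul_apply, smul_eq_mul]
  ring

theorem integral_lift_zero (φ : ℝ → ℝ) :
    ∫ x in (0 : ℝ)..1, lift (0 : L2T) x * φ x = 0 := by
  have h := integral_lift_smul 0 0 φ
  simpa using h

theorem HasWeakDeriv.zero : HasWeakDeriv 0 0 := by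
  intro φ _ _
  rw [integral_lift_zero, integral_lift_zero, neg_zero]

theorem HasWeakDeriv.add {f g f' g' : L2T} (h : HasWeakDeriv f g) (h' : HasWeakDeriv f' g') :
    HasWeakDeriv (f + f') (g + g') := by
  intro φ hφ hp
  rw [integral_lift_add _ _ (hφ.continuous_deriv (by simp)), integral_lift_add _ _ hφ.continuous,
    h φ hφ hp, h' φ hφ hp]
  ring

theorem HasWeakDeriv.smul {f g : L2T} (c : ℝ) (h : HasWeakDeriv f g) :
    HasWeakDeriv (c • f) (c • g) := by
  intro φ hφ hp
  rw [integral_lift_smul, integral_lift_smul, h φ hφ hp]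
  ring

theorem integral_eq_inner_one (f : L2T) :
    ∫ x, f x = inner ℝ (Lp.const 2 (volume : Measure UnitAddCircle) (1 : ℝ)) f := by
  rw [L2.inner_def]
  refine integral_congr_ae ?_
  filter_upwards [Lp.coeFn_const (p := 2) (μ := (volume : Measure UnitAddCircle)) (1 : ℝ)]
    with x hx
  rw [hx]
  simp

/-- An element of `L²(𝕋)` with zero mean which is orthogonal to the derivatives of all smooth
periodic functions is zero. -/
theorem eq_zero_of_integral_deriv (f : L2T) (h0 : ∫ x, f x = 0)
    (h : ∀ φ : ℝ → ℝ, ContDiff ℝ (⊤ : ℕ∞) φ → Function.Periodic φ 1 →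
      ∫ x in (0 : ℝ)..1, lift f x * deriv φ x = 0) : f = 0 := by
  have hC : MemLp (fun x => ((f x : ℝ) : ℂ)) 2 AddCircle.haarAddCircle :=
    memLp_haarAddCircle_iff.mpr (Lp.memLp f).ofReal
  have hcoef : ∀ n : ℤ, fourierCoeff (fun x => ((f x : ℝ) : ℂ)) n = 0 := by
    intro n
    rw [fourierCoeff_eq_intervalIntegral _ n 0, zero_add]
    have hcos : ∫ x in (0 : ℝ)..1, lift f x * Real.cos (2 * Real.pi * n * x) = 0 := by
      rcases eq_or_ne n 0 with rfl | hn
      · simpa [integral_lift] using h0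
      have hn' : (2 * Real.pi * n : ℝ) ≠ 0 := by
        have : (n : ℝ) ≠ 0 := by exact_mod_cast hn
        positivity
      have h1 := h (fun x => (2 * Real.pi * n)⁻¹ * Real.sin (2 * Real.pi * n * x))
        (by fun_prop) (by
          intro x
          have : 2 * Real.pi * n * (x + 1) = 2 * Real.pi * n * x + n * (2 * Real.pi) := by ring
          simp only [this, Real.sin_add_int_mul_two_pi])
      refine Eq.trans ?_ h1
      refine intervalIntegral.integral_congr fun x _ => ?_
      have hd : HasDerivAt (fun x : ℝ => (2 * Real.pi * n)⁻¹ * Real.sin (2 * Real.pi * n * x))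
          ((2 * Real.pi * n)⁻¹ * (Real.cos (2 * Real.pi * n * x) * (2 * Real.pi * n * 1))) x :=
        (((hasDerivAt_id x).const_mul (2 * Real.pi * n)).sin).const_mul _
      simp only [hd.deriv]
      field_simp
    have hsin : ∫ x in (0 : ℝ)..1, lift f x * Real.sin (2 * Real.pi * n * x) = 0 := by
      rcases eq_or_ne n 0 with rfl | hn
      · simp
      have hn' : (2 * Real.pi * n : ℝ) ≠ 0 := by
        have : (n : ℝ) ≠ 0 := by exact_mod_cast hn
        positivity
      have h1 := h (fun x => -(2 * Real.pi * n)⁻¹ * Real.cos (2 * Real.pi * n * x))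
        (by fun_prop) (by
          intro x
          have : 2 * Real.pi * n * (x + 1) = 2 * Real.pi * n * x + n * (2 * Real.pi) := by ring
          simp only [this, Real.cos_add_int_mul_two_pi])
      refine Eq.trans ?_ h1
      refine intervalIntegral.integral_congr fun x _ => ?_
      have hd : HasDerivAt (fun x : ℝ => -(2 * Real.pi * n)⁻¹ * Real.cos (2 * Real.pi * n * x))
          (-(2 * Real.pi * n)⁻¹ * (-Real.sin (2 * Real.pi * n * x) * (2 * Real.pi * n * 1))) x :=
        (((hasDerivAt_id x).const_mul (2 * Real.pi * n)).cos).const_mul _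
      simp only [hd.deriv]
      field_simp
    have hint : ∀ x : ℝ, (fourier (-n) (x : UnitAddCircle)) • ((f (x : UnitAddCircle) : ℝ) : ℂ)
        = ((lift f x * Real.cos (2 * Real.pi * n * x) : ℝ) : ℂ)
          - ((lift f x * Real.sin (2 * Real.pi * n * x) : ℝ) : ℂ) * Complex.I := by
      intro x
      rw [fourier_coe_apply]
      have : 2 * (Real.pi : ℂ) * Complex.I * ((-n : ℤ) : ℂ) * (x : ℂ) / ((1 : ℝ) : ℂ)
          = ((-(2 * Real.pi * n * x) : ℝ) : ℂ) * Complex.I := by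
        push_cast
        ring
      rw [this, Complex.exp_mul_I, ← Complex.ofReal_cos, ← Complex.ofReal_sin, Real.cos_neg,
        Real.sin_neg]
      simp only [lift, smul_eq_mul]
      push_cast
      ring
    have e : ∫ x in (0 : ℝ)..1,
        (fourier (-n) (x : UnitAddCircle)) • ((f (x : UnitAddCircle) : ℝ) : ℂ) = 0 := by
      simp_rw [hint]
      rw [intervalIntegral.integral_sub, intervalIntegral.integral_mul_const,
        intervalIntegral.integral_ofReal, intervalIntegral.integral_ofReal, hcos, hsin]
      · simp
      · have h1 : IntervalIntegrable (fun x => lift f x * Real.cos (2 * Real.pi * n * x))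
          volume 0 1 := intervalIntegrable_lift_mul f (by fun_prop)
        exact ⟨Integrable.ofReal h1.1, Integrable.ofReal h1.2⟩
      · have h1 : IntervalIntegrable (fun x => lift f x * Real.sin (2 * Real.pi * n * x))
          volume 0 1 := intervalIntegrable_lift_mul f (by fun_prop)
        exact IntervalIntegrable.mul_const ⟨Integrable.ofReal h1.1, Integrable.ofReal h1.2⟩ _
    rw [e, smul_zero]
  have hF : hC.toLp _ = 0 := by
    have hs := hasSum_fourier_series_L2 (hC.toLp _)
    have hz : ∀ i : ℤ, fourierCoeff (hC.toLp _) i = 0 := fun i => by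
      rw [fourierCoeff_congr_ae hC.coeFn_toLp, hcoef]
    simp only [hz, zero_smul] at hs
    exact hs.unique hasSum_zero
  have hae := (Lp.eq_zero_iff_ae_eq_zero).mp hF
  have hvol : (volume : Measure UnitAddCircle) = AddCircle.haarAddCircle := by
    rw [AddCircle.volume_eq_smul_haarAddCircle]
    simp
  rw [Lp.eq_zero_iff_ae_eq_zero]
  change ∀ᵐ x ∂(volume : Measure UnitAddCircle), f x = 0
  simp only [hvol]
  filter_upwards [hae, hC.coeFn_toLp] with x hx hx'
  rw [hx'] at hx
  simpa using hx

/-- Weak derivatives are unique. -/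
theorem HasWeakDeriv.unique {f g g' : L2T} (h : HasWeakDeriv f g) (h' : HasWeakDeriv f g') :
    g = g' := by
  have hd : HasWeakDeriv 0 (g + (-1 : ℝ) • g') := by
    have := h.add (h'.smul (-1))
    simpa using this
  have key : ∀ φ : ℝ → ℝ, ContDiff ℝ (⊤ : ℕ∞) φ → Function.Periodic φ 1 →
      ∫ x in (0 : ℝ)..1, lift (g + (-1 : ℝ) • g') x * φ x = 0 := by
    intro φ hφ hp
    have := hd φ hφ hp
    rw [integral_lift_zero] at this
    linarith
  have hz : g + (-1 : ℝ) • g' = 0 := by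
    refine eq_zero_of_integral_deriv _ ?_ fun φ hφ hp => ?_
    · have := key (fun _ => 1) contDiff_const (fun _ => rfl)
      simpa [integral_lift] using this
    · refine key (deriv φ) ?_ fun x => ?_
      · exact (contDiff_infty_iff_deriv.mp hφ).2
      · rw [← deriv_comp_add_const, show (fun y => φ (y + 1)) = φ from funext hp]
  rw [neg_one_smul, ← sub_eq_add_neg] at hz
  exact sub_eq_zero.mp hz

/-- `𝓗₀`: the real functions in `L²(𝕋)` with zero mean, with the `L²`-norm. -/
def H0 : Submodule ℝ L2T where
  carrier := {f | ∫ x, f x = 0}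
  zero_mem' := by
    simp only [Set.mem_ofPred_eq, integral_eq_inner_one, inner_zero_right]
  add_mem' := by
    intro f g hf hg
    simp only [Set.mem_ofPred_eq, integral_eq_inner_one] at hf hg ⊢
    rw [inner_add_right, hf, hg, add_zero]
  smul_mem' := by
    intro c f hf
    simp only [Set.mem_ofPred_eq, integral_eq_inner_one] at hf ⊢
    rw [inner_smul_right, hf, mul_zero]

theorem mem_H0 {f : L2T} : f ∈ H0 ↔ ∫ x, f x = 0 := Iff.rfl

instance : CompleteSpace H0 := by
  have : IsClosed (H0 : Set L2T) := by
    have : (H0 : Set L2T) = {f | inner ℝ (Lp.const 2 (volume : Measure UnitAddCircle) (1 : ℝ)) f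
        = (0 : ℝ)} := by
      ext f
      simp only [SetLike.mem_coe, mem_H0, Set.mem_ofPred_eq, integral_eq_inner_one]
    rw [this]
    exact isClosed_eq (by fun_prop) continuous_const
  exact this.completeSpace_coe

/-- The underlying vector space of `𝓗₁`: functions in `L²(𝕋)` with zero mean and a weak
derivative in `L²(𝕋)`. -/
def h1Submodule : Submodule ℝ L2T where
  carrier := {q | ∫ x, q x = 0 ∧ ∃ g : L2T, HasWeakDeriv q g}
  zero_mem' := ⟨H0.zero_mem, 0, HasWeakDeriv.zero⟩
  add_mem' := by
    rintro f g ⟨hf, f', hf'⟩ ⟨hg, g', hg'⟩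
    exact ⟨H0.add_mem hf hg, _, hf'.add hg'⟩
  smul_mem' := by
    rintro c f ⟨hf, f', hf'⟩
    exact ⟨H0.smul_mem c hf, _, hf'.smul c⟩

/-- The Sobolev space `𝓗₁`. It is a separate type because it carries the norm `‖q'‖` of `L²(𝕋)`,
not the restriction of the `L²`-norm. -/
def H1 : Type := h1Submodule

namespace H1

instance : AddCommGroup H1 := inferInstanceAs (AddCommGroup h1Submodule)

instance : Module ℝ H1 := inferInstanceAs (Module ℝ h1Submodule)

/-- The inclusion of `𝓗₁` into `L²(𝕋)`. -/
def toL2 : H1 →ₗ[ℝ] L2T := h1Submodule.subtype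

theorem toL2_injective : Function.Injective toL2 := h1Submodule.injective_subtype

theorem integral_toL2 (q : H1) : ∫ x, toL2 q x = 0 := q.2.1

theorem exists_hasWeakDeriv (q : H1) : ∃ g : L2T, HasWeakDeriv (toL2 q) g := q.2.2

/-- The weak derivative `q ↦ q'`, from `𝓗₁` to `L²(𝕋)`. -/
def weakDeriv : H1 →ₗ[ℝ] L2T where
  toFun q := (exists_hasWeakDeriv q).choose
  map_add' p q := by
    refine (exists_hasWeakDeriv (p + q)).choose_spec.unique ?_
    rw [map_add]
    exact (exists_hasWeakDeriv p).choose_spec.add (exists_hasWeakDeriv q).choose_spec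
  map_smul' c q := by
    refine (exists_hasWeakDeriv (c • q)).choose_spec.unique ?_
    rw [map_smul]
    exact (exists_hasWeakDeriv q).choose_spec.smul c

theorem hasWeakDeriv (q : H1) : HasWeakDeriv (toL2 q) (weakDeriv q) :=
  (exists_hasWeakDeriv q).choose_spec

theorem weakDeriv_injective : Function.Injective weakDeriv := by
  rw [injective_iff_map_eq_zero]
  intro q hq
  apply toL2_injective
  rw [map_zero]
  refine eq_zero_of_integral_deriv _ (integral_toL2 q) fun φ hφ hp => ?_
  rw [hasWeakDeriv q φ hφ hp, hq, integral_lift_zero, neg_zero]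

/-- The norm of `𝓗₁` is `‖q‖₁ = ‖q'‖`, the `L²`-norm of the derivative. -/
instance : NormedAddCommGroup H1 :=
  NormedAddCommGroup.induced H1 L2T weakDeriv weakDeriv_injective

theorem norm_def (q : H1) : ‖q‖ = ‖weakDeriv q‖ := rfl

/-- The inner product of `𝓗₁` is `(p, q) ↦ ∫ p' q'`. -/
instance : InnerProductSpace ℝ H1 where
  norm_smul_le c q := by
    rw [norm_def, norm_def, map_smul, norm_smul]
  inner p q := inner ℝ (weakDeriv p) (weakDeriv q)
  norm_sq_eq_re_inner q := norm_sq_eq_re_inner (weakDeriv q)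
  conj_inner_symm p q := inner_conj_symm (weakDeriv p) (weakDeriv q)
  add_left p q s := by
    rw [map_add, inner_add_left]
  smul_left p q c := by
    rw [map_smul, inner_smul_left]

theorem integral_weakDeriv (q : H1) : ∫ x, weakDeriv q x = 0 := by
  have h := hasWeakDeriv q (fun _ => 1) contDiff_const (fun _ => rfl)
  simpa [integral_lift] using h

/-- The derivative maps `𝓗₁` onto `𝓗₀`. -/
theorem range_weakDeriv : Set.range weakDeriv = (H0 : Set L2T) := by
  ext g
  constructor
  · rintro ⟨q, rfl⟩
    exact integral_weakDeriv q
  intro hg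
  have hg0 : ∫ x in (0 : ℝ)..1, lift g x = 0 := by rw [integral_lift]; exact hg
  set c : ℝ := ∫ x in (0 : ℝ)..1, ∫ t in (0 : ℝ)..x, lift g t with hc
  set G : ℝ → ℝ := fun x => (∫ t in (0 : ℝ)..x, lift g t) - c with hG
  have hac0 : AbsolutelyContinuousOnInterval (fun x => ∫ t in (0 : ℝ)..x, lift g t) 0 1 :=
    (intervalIntegrable_lift g).absolutelyContinuousOnInterval_intervalIntegral (by simp)
  have hac : AbsolutelyContinuousOnInterval G 0 1 := by
    refine hac0.fun_sub ?_
    exact ContDiffOn.absolutelyContinuousOnInterval contDiffOn_const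
  have hcont : ContinuousOn G (Set.Icc 0 1) := by
    simpa using hac.continuousOn
  have hGmem : MemLp G 2 (volume.restrict (Set.Ioc (0 : ℝ) (0 + 1))) := by
    rw [zero_add]
    obtain ⟨B, hB⟩ := isCompact_Icc.exists_bound_of_continuousOn hcont
    refine MemLp.of_bound ((hcont.mono Set.Ioc_subset_Icc_self).aestronglyMeasurable
      measurableSet_Ioc) B ?_
    filter_upwards [ae_restrict_mem measurableSet_Ioc] with x hx
    exact hB x (Set.Ioc_subset_Icc_self hx)
  have hmem : MemLp (AddCircle.liftIoc 1 0 G) 2 (volume : Measure UnitAddCircle) := by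
    simp only [AddCircle.liftIoc, Set.domRestrict_def, Function.comp_def]
    apply hGmem.comp_measurePreserving
    refine .comp (measurePreserving_subtype_coe measurableSet_Ioc) ?_
    exact AddCircle.measurePreserving_equivIoc 1
  have hae : ∀ᵐ x ∂(volume.restrict (Set.Ioc (0 : ℝ) 1)), lift (hmem.toLp _) x = G x := by
    have h1 := ae_lift (P := fun x y => lift (hmem.toLp _) x = AddCircle.liftIoc 1 0 G y)
      hmem.coeFn_toLp (fun x hx => hx)
    filter_upwards [h1, ae_restrict_mem measurableSet_Ioc] with x hx hx'
    rw [hx, AddCircle.liftIoc_coe_apply (by simpa using hx')]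
  have hint : ∀ ψ : ℝ → ℝ, ∫ x in (0 : ℝ)..1, lift (hmem.toLp _) x * ψ x
      = ∫ x in (0 : ℝ)..1, G x * ψ x := by
    intro ψ
    rw [intervalIntegral.integral_of_le zero_le_one, intervalIntegral.integral_of_le zero_le_one]
    refine integral_congr_ae ?_
    filter_upwards [hae] with x hx
    rw [hx]
  have hmean : ∫ x, hmem.toLp _ x = 0 := by
    have h1 := hint (fun _ => 1)
    simp only [mul_one, integral_lift] at h1
    rw [h1, hG, intervalIntegral.integral_sub hac0.continuousOn.intervalIntegrable (by simp)]
    simp [hc]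
  have hweak : HasWeakDeriv (hmem.toLp _) g := by
    intro φ hφ hp
    have hφac : AbsolutelyContinuousOnInterval φ 0 1 :=
      ContDiffOn.absolutelyContinuousOnInterval (hφ.of_le (by simp)).contDiffOn
    rw [hint, hac.integral_mul_deriv_eq_deriv_mul hφac]
    have e1 : ∫ x in (0 : ℝ)..1, deriv G x * φ x = ∫ x in (0 : ℝ)..1, lift g x * φ x := by
      refine intervalIntegral.integral_congr_ae ?_
      filter_upwards [(intervalIntegrable_lift g).ae_hasDerivAt_integral] with x hx hx'
      rw [((hx (Set.uIoc_subset_uIcc hx') 0 (by simp)).sub_const c).deriv]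
    have e2 : φ 1 = φ 0 := by simpa using hp 0
    rw [e1, e2]
    simp [hG, hg0]
  have hq : hmem.toLp _ ∈ h1Submodule := ⟨hmean, g, hweak⟩
  exact ⟨(⟨hmem.toLp _, hq⟩ : h1Submodule), (hasWeakDeriv _).unique hweak⟩

instance : CompleteSpace H1 := by
  let D : H1 →ₗᵢ[ℝ] L2T := ⟨weakDeriv, fun _ => rfl⟩
  have hD : IsComplete (Set.range D) := by
    change IsComplete (Set.range weakDeriv)
    rw [range_weakDeriv]
    exact (completeSpace_coe_iff_isComplete (s := (H0 : Set L2T))).mp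
      (inferInstanceAs (CompleteSpace H0))
  have h := (D.isometry.isUniformInducing.isComplete_iff (s := Set.univ)).mp
    (by rwa [Set.image_univ])
  exact completeSpace_iff_isComplete_univ.mpr h

end H1

/-- The Ricci eigenvalue `ℰ = -v' - v²/m` with `v = 2q` (a function on `𝕋`, defined almost
everywhere). It is the eigenvalue in the direction `dx` of the Ricci tensor of the warped product
metric `dx² + r(x)² g_Y`, `m = dim Y`, `r'/r = v/m`. -/
def ricciEigenvalue (m : ℕ) (q : H1) (x : UnitAddCircle) : ℝ :=
  - H1.weakDeriv ((2 : ℝ) • q) x - (H1.toL2 ((2 : ℝ) • q) x) ^ 2 / m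

/-- The constant part `ℰ₀ = ∫ ℰ dx` of the Ricci eigenvalue. -/
def ricciConst (m : ℕ) (q : H1) : ℝ := ∫ x, ricciEigenvalue m q x

/-- The non-constant part `ℰ₁ = -v' - v²/m + (1/m) ∫ v² dx`, `v = 2q`, of the Ricci eigenvalue. -/
def ricciNonconst (m : ℕ) (q : H1) (x : UnitAddCircle) : ℝ :=
  - H1.weakDeriv ((2 : ℝ) • q) x - (H1.toL2 ((2 : ℝ) • q) x) ^ 2 / m
    + (1 / m) * ∫ t, (H1.toL2 ((2 : ℝ) • q) t) ^ 2

/-- The profile (radius of rotation) `r(x) = r₀ exp((2/m) ∫₀ˣ q(t) dt)`, a positive 1-periodic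
function on `ℝ`. -/
def profile (m : ℕ) (r₀ : ℝ) (q : H1) (x : ℝ) : ℝ :=
  r₀ * Real.exp ((2 / m) * ∫ t in (0 : ℝ)..x, lift (H1.toL2 q) t)

/-- The Gaussian curvature, in orthogonal coordinates, of the metric `A dx² + B dy²`:
`K = -(1 / (2 √(AB))) (∂ₓ(∂ₓB / √(AB)) + ∂_y(∂_yA / √(AB)))`. -/
def gaussianCurvature (A B : ℝ → ℝ → ℝ) (x y : ℝ) : ℝ :=
  -(1 / (2 * √(A x y * B x y))) *
    (deriv (fun s => deriv (fun s' => B s' y) s / √(A s y * B s y)) x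
      + deriv (fun t => deriv (fun t' => A x t') t / √(A x t * B x t)) y)

/-- The Gaussian curvature of the surface of rotation type `dx² + r(x)² dy²` with profile `r`. -/
def rotationalCurvature (r : ℝ → ℝ) (x y : ℝ) : ℝ :=
  gaussianCurvature (fun _ _ => 1) (fun s _ => r s ^ 2) x y

end PerturbedTorus

end

/-! ### Periodic lifts and integral bounds on the circle. -/

noncomputable section

namespace PerturbedTorus

/-! Put `κ = 1/m` and `Φ(v) = -(v' + κ (v² - ∫ v²))`, so that `ℰ₁ = Φ(2q)`. Since `∫ v' v² = 0` on
the circle, the two terms of `Φ` are orthogonal and `‖Φ(v)‖² = ‖v'‖² + κ² ‖v² - ∫ v²‖²`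
(`norm_riccati_sq`). This gives the lower estimate, which is also coercivity. The upper estimate
follows from `∫ v⁴ ≤ ‖v‖∞² ‖v‖²` and `‖v‖∞ ≤ ‖v'‖`.

Because `Φ` is quadratic, `Φ(v) - Φ(w) = -L_s(v - w)` with `s = κ(v + w)` and `L_s w = w' + sw - ∫
sw`; likewise `Φ'(v) = -L_s` with `s = 2κv`. Everything therefore rests on `L_s`. The integrating
factor `exp ∫ s`, periodic because `s` has zero mean, bounds `L_s` below uniformly for `s` in a ball
(`exists_norm_le_riccatiLin`). Deforming `s` to `0`, where `L_0` is the isometry `w ↦ w'`, shows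
that `L_s` is an isomorphism (`exists_equiv_riccatiLin`).

Hence `Φ` is injective. Its range is open by the inverse function theorem, and closed by coercivity
together with the Lipschitz bound for the inverse on balls; as `𝓗₀` is connected, `Φ` is onto. The
analytic inverse function theorem makes the inverse analytic. Taking means in `ℰ = e + F` forces `e
= ℰ₀` and `ℰ₁ = F`, which gives existence and uniqueness of the pair. For `m = 1`, `r' = rv` turns
the curvature `-r''/r` into `-v' - v² = ℰ`. -/

theorem lift_periodic (f : L2T) : Function.Periodic (lift f) 1 := by
  intro x
  simp only [lift, AddCircle.coe_add_period]

theorem intervalIntegrable_lift_of_le (f : L2T) (a b : ℝ) :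
    IntervalIntegrable (lift f) volume a b :=
  (lift_periodic f).intervalIntegrable₀ one_ne_zero (intervalIntegrable_lift f) a b

theorem locallyIntegrable_lift (f : L2T) : LocallyIntegrable (lift f) volume := by
  rw [locallyIntegrable_iff]
  intro K hK
  obtain ⟨R, hR⟩ := hK.isBounded.subset_closedBall 0
  refine IntegrableOn.mono_set ?_ hR
  rw [Real.closedBall_eq_Icc, integrableOn_Icc_iff_integrableOn_Ioc]
  exact (intervalIntegrable_lift_of_le f _ _).1

/-- Almost every point of the circle satisfies `Q` iff almost every point of the line does. -/
theorem ae_coe_iff {Q : UnitAddCircle → Prop} :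
    (∀ᵐ x : ℝ, Q (x : UnitAddCircle)) ↔ ∀ᵐ x : UnitAddCircle, Q x := by
  constructor
  · intro h
    have h1 : ∀ᵐ x : Set.Ioc (0 : ℝ) (0 + 1) ∂(Measure.comap Subtype.val volume),
        Q ((x : ℝ) : UnitAddCircle) :=
      (measurePreserving_subtype_coe measurableSet_Ioc).quasiMeasurePreserving.ae
        (ae_restrict_of_ae h)
    have h2 := (AddCircle.measurePreserving_equivIoc (T := 1) (a := 0)).quasiMeasurePreserving.ae h1
    filter_upwards [h2] with x hx
    have := (AddCircle.equivIoc (1 : ℝ) 0).symm_apply_apply x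
    change Q (((AddCircle.equivIoc (1 : ℝ) 0 x : ℝ)) : UnitAddCircle) at hx
    have e : ((AddCircle.equivIoc (1 : ℝ) 0 x : ℝ) : UnitAddCircle) = x := this
    rwa [e] at hx
  · intro h
    have h1 : ∀ n : ℤ, ∀ᵐ x : ℝ, x ∈ Set.Ioc (n : ℝ) (n + 1) → Q (x : UnitAddCircle) := fun n =>
      (ae_restrict_iff' measurableSet_Ioc).mp
        ((UnitAddCircle.measurePreserving_mk n).quasiMeasurePreserving.ae h)
    filter_upwards [ae_all_iff.mpr h1] with x hx
    -- The intervals are open on the left, so the ceiling minus one is needed; the floor would fail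
    -- at integers.
    refine hx (⌈x⌉ - 1) ⟨?_, ?_⟩ <;> push_cast
    · linarith [Int.ceil_lt_add_one x]
    · linarith [Int.le_ceil x]

theorem exists_mem_Icc_coe_eq (x : UnitAddCircle) :
    ∃ y ∈ Set.Icc (0 : ℝ) 1, (y : UnitAddCircle) = x := by
  have h := (AddCircle.equivIoc (1 : ℝ) 0 x).2
  refine ⟨AddCircle.equivIoc (1 : ℝ) 0 x, ⟨h.1.le, h.2.trans_eq (zero_add 1)⟩, ?_⟩
  exact (AddCircle.equivIoc (1 : ℝ) 0).symm_apply_apply x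

instance : IsProbabilityMeasure (volume : Measure UnitAddCircle) :=
  ⟨UnitAddCircle.measure_univ⟩

theorem norm_const_one : ‖Lp.const 2 (volume : Measure UnitAddCircle) (1 : ℝ)‖ = 1 := by
  rw [Lp.norm_const]
  · simp [Measure.real]
  · norm_num

theorem integral_abs_le (f : L2T) : ∫ x, |f x| ≤ ‖f‖ := by
  have h1 : ∫ x, |f x| = ∫ x, (|f| : L2T) x :=
    integral_congr_ae ((Lp.coeFn_abs f).mono fun x hx => hx.symm)
  rw [h1, integral_eq_inner_one]
  refine (real_inner_le_norm _ _).trans ?_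
  rw [norm_const_one, one_mul, norm_abs_eq_norm]

/-- The total mass is `1`, so the `L¹` norm is at most the `L²` norm. The endpoints may come in
either order, which allows integration from a zero of a function to an arbitrary point. -/
theorem abs_integral_lift_mul_le (f : L2T) {φ : ℝ → ℝ} (hφ : Continuous φ) {E : ℝ}
    (hE : ∀ x ∈ Set.Icc (0 : ℝ) 1, |φ x| ≤ E) {a b : ℝ} (ha : a ∈ Set.Icc (0 : ℝ) 1)
    (hb : b ∈ Set.Icc (0 : ℝ) 1) : |∫ x in a..b, lift f x * φ x| ≤ ‖f‖ * E := by
  have hE0 : 0 ≤ E := (abs_nonneg _).trans (hE 0 (by simp))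
  refine le_trans ?_ (mul_le_mul_of_nonneg_right (integral_abs_le f) hE0)
  have h := UnitAddCircle.intervalIntegral_preimage 0 (fun x => |f x|)
  rw [← h, zero_add, intervalIntegral.integral_of_le zero_le_one, ← Real.norm_eq_abs,
    ← integral_mul_const]
  have hsub : Set.uIoc a b ⊆ Set.Ioc 0 1 := fun x hx => by
    rw [Set.uIoc] at hx
    exact ⟨lt_of_le_of_lt (le_min ha.1 hb.1) hx.1, hx.2.trans (max_le ha.2 hb.2)⟩
  have hi : IntegrableOn (fun x => |lift f x| * E) (Set.Ioc 0 1) :=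
    (intervalIntegrable_lift f).1.norm.mul_const E
  refine (intervalIntegral.norm_integral_le_integral_norm_uIoc).trans
    (le_trans (setIntegral_mono_on ?_ (hi.mono_set hsub) measurableSet_uIoc fun x hx => ?_)
      (setIntegral_mono_set hi ?_ ?_))
  · exact (intervalIntegrable_iff.mp
      ((intervalIntegrable_lift_of_le f a b).mul_continuousOn hφ.continuousOn)).norm
  · rw [norm_mul]
    exact mul_le_mul_of_nonneg_left (hE x (Set.Ioc_subset_Icc_self (hsub hx))) (norm_nonneg _)
  · exact Filter.Eventually.of_forall fun x => mul_nonneg (abs_nonneg _) hE0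
  · exact Filter.Eventually.of_forall hsub

/-! ### Continuous representatives and the Sobolev embedding. -/

namespace H1

/-- The representative is the primitive of `q'` normalised to mean zero. It is periodic because `q'`
has zero mean, and it is `q` because an element of `𝓗₁` is determined by its weak derivative. -/
theorem exists_continuous_rep (q : H1) : ∃ c : C(UnitAddCircle, ℝ),
    ContinuousMap.toLp 2 volume ℝ c = toL2 q ∧
      ∀ a b : ℝ, ∫ x in a..b, lift (weakDeriv q) x = c (b : UnitAddCircle) - c a := by
  set g := weakDeriv q with hg
  have hg0 : ∫ x in (0 : ℝ)..1, lift g x = 0 := by rw [integral_lift]; exact integral_weakDeriv q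
  have hint := intervalIntegrable_lift_of_le g
  set m : ℝ := ∫ x in (0 : ℝ)..1, ∫ t in (0 : ℝ)..x, lift g t with hm
  set G : ℝ → ℝ := fun x => (∫ t in (0 : ℝ)..x, lift g t) - m with hG
  have hsub : ∀ a b : ℝ, ∫ x in a..b, lift g x = G b - G a := by
    intro a b
    rw [← intervalIntegral.integral_interval_sub_left (hint 0 b) (hint 0 a)]
    simp only [hG]
    ring
  have hper : Function.Periodic G 1 := by
    intro x
    have := hsub x (x + 1)
    rw [(lift_periodic g).intervalIntegral_add_eq x 0, zero_add, hg0] at this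
    linarith
  have hcont0 : Continuous fun x => ∫ t in (0 : ℝ)..x, lift g t :=
    intervalIntegral.continuous_primitive hint 0
  have hcont : Continuous G := hcont0.sub continuous_const
  let c : C(UnitAddCircle, ℝ) := ⟨hper.lift, continuous_coinduced_dom.mpr hcont⟩
  have hc : ∀ x : ℝ, c (x : UnitAddCircle) = G x := fun x => rfl
  refine ⟨c, ?_, fun a b => by rw [hc, hc, hsub]⟩
  set u : L2T := ContinuousMap.toLp 2 volume ℝ c with hu
  have hae : ∀ᵐ x ∂(volume.restrict (Set.Ioc (0 : ℝ) 1)), lift u x = G x :=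
    ae_lift (P := fun x y => lift u x = c y) (ContinuousMap.coeFn_toLp volume c) (fun x hx => hx)
  have hintu : ∀ ψ : ℝ → ℝ, ∫ x in (0 : ℝ)..1, lift u x * ψ x = ∫ x in (0 : ℝ)..1, G x * ψ x := by
    intro ψ
    rw [intervalIntegral.integral_of_le zero_le_one, intervalIntegral.integral_of_le zero_le_one]
    refine integral_congr_ae ?_
    filter_upwards [hae] with x hx
    rw [hx]
  have hmean : ∫ x, u x = 0 := by
    have h1 := hintu (fun _ => 1)
    simp only [mul_one, integral_lift] at h1
    rw [h1, hG, intervalIntegral.integral_sub hcont0.continuousOn.intervalIntegrable (by simp)]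
    simp [hm]
  have hac : AbsolutelyContinuousOnInterval G 0 1 := by
    refine ((hint 0 1).absolutelyContinuousOnInterval_intervalIntegral (by simp)).fun_sub ?_
    exact ContDiffOn.absolutelyContinuousOnInterval contDiffOn_const
  have hweak : HasWeakDeriv u g := by
    intro φ hφ hp
    have hφac : AbsolutelyContinuousOnInterval φ 0 1 :=
      ContDiffOn.absolutelyContinuousOnInterval (hφ.of_le (by simp)).contDiffOn
    rw [hintu, hac.integral_mul_deriv_eq_deriv_mul hφac]
    have e1 : ∫ x in (0 : ℝ)..1, deriv G x * φ x = ∫ x in (0 : ℝ)..1, lift g x * φ x := by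
      refine intervalIntegral.integral_congr_ae ?_
      filter_upwards [LocallyIntegrable.ae_hasDerivAt_integral (locallyIntegrable_lift g)] with x hx _
      rw [((hx 0).sub_const m).deriv]
    have e2 : φ 1 = φ 0 := by simpa using hp 0
    rw [e1, e2]
    simp [hG, hg0]
  have hmem : u ∈ h1Submodule := ⟨hmean, g, hweak⟩
  have : (⟨u, hmem⟩ : h1Submodule) = q :=
    weakDeriv_injective ((hasWeakDeriv (⟨u, hmem⟩ : h1Submodule)).unique hweak)
  rw [← this]
  rfl

/-- The inclusion of `𝓗₁` into the continuous functions, as a linear map. -/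
def toContinuousₗ : H1 →ₗ[ℝ] C(UnitAddCircle, ℝ) where
  toFun q := (exists_continuous_rep q).choose
  map_add' p q := by
    apply ContinuousMap.toLp_injective (p := 2) (𝕜 := ℝ) (volume : Measure UnitAddCircle)
    rw [(exists_continuous_rep (p + q)).choose_spec.1, map_add, map_add,
      (exists_continuous_rep p).choose_spec.1, (exists_continuous_rep q).choose_spec.1]
  map_smul' c q := by
    apply ContinuousMap.toLp_injective (p := 2) (𝕜 := ℝ) (volume : Measure UnitAddCircle)
    rw [(exists_continuous_rep (c • q)).choose_spec.1, map_smul, map_smul,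
      (exists_continuous_rep q).choose_spec.1]
    rfl

theorem toLp_toContinuousₗ (q : H1) :
    ContinuousMap.toLp 2 volume ℝ (toContinuousₗ q) = toL2 q :=
  (exists_continuous_rep q).choose_spec.1

theorem integral_lift_weakDeriv (q : H1) (a b : ℝ) : ∫ x in a..b, lift (weakDeriv q) x
    = toContinuousₗ q (b : UnitAddCircle) - toContinuousₗ q (a : UnitAddCircle) :=
  (exists_continuous_rep q).choose_spec.2 a b

theorem coeFn_toContinuousₗ (q : H1) : (toL2 q : UnitAddCircle → ℝ) =ᵐ[volume] toContinuousₗ q := by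
  rw [← toLp_toContinuousₗ q]
  exact ContinuousMap.coeFn_toLp volume _

theorem integral_toContinuousₗ (q : H1) : ∫ x, toContinuousₗ q x = 0 := by
  rw [← integral_congr_ae (coeFn_toContinuousₗ q), integral_toL2]

theorem exists_toContinuousₗ_eq_zero (q : H1) :
    ∃ x ∈ Set.Icc (0 : ℝ) 1, toContinuousₗ q (x : UnitAddCircle) = 0 := by
  have hi : Integrable (toContinuousₗ q) volume :=
    (toContinuousₗ q).continuous.integrable_of_hasCompactSupport
      (HasCompactSupport.of_compactSpace _)
  obtain ⟨a, ha⟩ := exists_le_integral hi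
  obtain ⟨b, hb⟩ := exists_integral_le hi
  rw [integral_toContinuousₗ] at ha hb
  obtain ⟨x, hx⟩ := mem_range_of_exists_le_of_exists_ge (toContinuousₗ q).continuous
    ⟨a, ha⟩ ⟨b, hb⟩
  obtain ⟨y, hy, rfl⟩ := exists_mem_Icc_coe_eq x
  exact ⟨y, hy, hx⟩

/-- A mean-zero continuous function vanishes somewhere; integrating `q'` from that zero gives the
bound. The constant `1` is what the upper estimate of the corollary requires. -/
theorem norm_toContinuousₗ_le (q : H1) : ‖toContinuousₗ q‖ ≤ 1 * ‖q‖ := by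
  rw [one_mul, ContinuousMap.norm_le _ (norm_nonneg _)]
  intro x
  obtain ⟨z, hz, hz0⟩ := exists_toContinuousₗ_eq_zero q
  obtain ⟨y, hy, rfl⟩ := exists_mem_Icc_coe_eq x
  have h := abs_integral_lift_mul_le (weakDeriv q) (φ := fun _ => 1) continuous_const (E := 1)
    (by simp) hz hy
  simp only [mul_one] at h
  rwa [integral_lift_weakDeriv, hz0, sub_zero] at h

/-- The Sobolev embedding of `𝓗₁` into the continuous functions. -/
def toContinuous : H1 →L[ℝ] C(UnitAddCircle, ℝ) :=
  toContinuousₗ.mkContinuous 1 norm_toContinuousₗ_le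

end H1

/-! ### The projection onto mean-zero functions. -/

/-- The constant function `1` in `L²(𝕋)`. -/
abbrev oneL2 : L2T := Lp.const 2 (volume : Measure UnitAddCircle) (1 : ℝ)

/-- The orthogonal projection `f ↦ f - ∫ f` of `L²(𝕋)` onto `𝓗₀`. -/
def meanProj : L2T →L[ℝ] H0 :=
  (ContinuousLinearMap.id ℝ L2T - (innerSL ℝ oneL2).smulRight oneL2).codRestrict H0 fun f => by
    rw [mem_H0, integral_eq_inner_one]
    simp [inner_sub_right, inner_smul_right, norm_const_one]

theorem coe_meanProj (f : L2T) : (meanProj f : L2T) = f - (∫ x, f x) • oneL2 := by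
  rw [integral_eq_inner_one]
  rfl

theorem coeFn_meanProj (f : L2T) :
    ((meanProj f : L2T) : UnitAddCircle → ℝ) =ᵐ[volume] fun x => f x - ∫ t, f t := by
  rw [coe_meanProj]
  filter_upwards [Lp.coeFn_sub f ((∫ x, f x) • oneL2), Lp.coeFn_smul (∫ x, f x) oneL2,
    Lp.coeFn_const (p := 2) (μ := (volume : Measure UnitAddCircle)) (1 : ℝ)] with x h1 h2 h3
  rw [h1, Pi.sub_apply, h2, Pi.smul_apply, h3]
  simp

theorem norm_meanProj_sq (f : L2T) : ‖meanProj f‖ ^ 2 = ‖f‖ ^ 2 - (∫ x, f x) ^ 2 := by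
  rw [Submodule.coe_norm, coe_meanProj, norm_sub_sq_real, inner_smul_right, norm_smul,
    norm_const_one, real_inner_comm, ← integral_eq_inner_one, Real.norm_eq_abs, mul_one, sq_abs]
  ring

theorem norm_meanProj_le (f : L2T) : ‖meanProj f‖ ≤ ‖f‖ := by
  refine abs_le_of_sq_le_sq' ?_ (norm_nonneg _) |>.2
  rw [norm_meanProj_sq]
  linarith [sq_nonneg (∫ x, f x)]

theorem inner_meanProj (h : H0) (f : L2T) : inner ℝ h (meanProj f) = inner ℝ (h : L2T) f := by
  rw [Submodule.coe_inner, coe_meanProj, inner_sub_right, inner_smul_right,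
    real_inner_comm oneL2, ← integral_eq_inner_one (h : L2T), mem_H0.mp h.2]
  simp

theorem norm_toLp_sq (c : C(UnitAddCircle, ℝ)) :
    ‖(ContinuousMap.toLp 2 volume ℝ c : L2T)‖ ^ 2 = ∫ x, c x ^ 2 := by
  rw [← real_inner_self_eq_norm_sq, L2.inner_def]
  refine integral_congr_ae ?_
  filter_upwards [ContinuousMap.coeFn_toLp (p := 2) (𝕜 := ℝ) volume c] with x hx
  rw [hx]
  simp [sq]

theorem norm_toLp_le (c : C(UnitAddCircle, ℝ)) :
    ‖(ContinuousMap.toLp 2 volume ℝ c : L2T)‖ ≤ ‖c‖ := by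
  refine abs_le_of_sq_le_sq' ?_ (norm_nonneg _) |>.2
  rw [norm_toLp_sq]
  have : ∫ x : UnitAddCircle, c x ^ 2 ≤ ∫ x : UnitAddCircle, ‖c‖ ^ 2 := by
    refine integral_mono ?_ (by simp) fun x => ?_
    · exact (c.continuous.pow 2).integrable_of_hasCompactSupport
        (HasCompactSupport.of_compactSpace _)
    · exact sq_le_sq' (neg_le_of_abs_le (c.norm_coe_le_norm x)) (le_of_abs_le (c.norm_coe_le_norm x))
  simpa using this

/-! ### Calculus in `𝓗₁`, products, and the orthogonality of `v'` and `v²`. -/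

namespace H1

theorem toContinuous_apply (q : H1) : toContinuous q = toContinuousₗ q := rfl

theorem norm_toContinuous_le (q : H1) : ‖toContinuous q‖ ≤ ‖q‖ := by
  rw [toContinuous_apply]
  simpa using norm_toContinuousₗ_le q

theorem toLp_toContinuous (q : H1) : ContinuousMap.toLp 2 volume ℝ (toContinuous q) = toL2 q :=
  toLp_toContinuousₗ q

theorem coeFn_toContinuous (q : H1) : (toL2 q : UnitAddCircle → ℝ) =ᵐ[volume] toContinuous q :=
  coeFn_toContinuousₗ q

theorem integral_lift_weakDeriv' (q : H1) (a b : ℝ) : ∫ x in a..b, lift (weakDeriv q) x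
    = toContinuous q (b : UnitAddCircle) - toContinuous q (a : UnitAddCircle) :=
  integral_lift_weakDeriv q a b

theorem toContinuous_coe_eq (q : H1) : (fun x : ℝ => toContinuous q (x : UnitAddCircle)) =
    fun x => (∫ t in (0 : ℝ)..x, lift (weakDeriv q) t) + toContinuous q ((0 : ℝ) : UnitAddCircle) := by
  funext x
  rw [integral_lift_weakDeriv']
  ring

theorem absolutelyContinuousOnInterval_toContinuous (q : H1) (a b : ℝ) :
    AbsolutelyContinuousOnInterval (fun x : ℝ => toContinuous q (x : UnitAddCircle)) a b := by
  have e : (fun x : ℝ => toContinuous q (x : UnitAddCircle)) =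
    fun x => (∫ t in a..x, lift (weakDeriv q) t) + toContinuous q (a : UnitAddCircle) := by
    funext x
    rw [integral_lift_weakDeriv']
    ring
  rw [e]
  refine ((intervalIntegrable_lift_of_le _ a b).absolutelyContinuousOnInterval_intervalIntegral
    (by simp)).fun_add ?_
  exact ContDiffOn.absolutelyContinuousOnInterval contDiffOn_const

theorem ae_hasDerivAt_toContinuous (q : H1) : ∀ᵐ x : ℝ,
    HasDerivAt (fun x : ℝ => toContinuous q (x : UnitAddCircle)) (lift (weakDeriv q) x) x := by
  rw [toContinuous_coe_eq]
  filter_upwards [LocallyIntegrable.ae_hasDerivAt_integral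
    (locallyIntegrable_lift (weakDeriv q))] with x hx
  exact (hx 0).add_const _

/-- The derivative, as an isometric isomorphism of `𝓗₁` onto `𝓗₀`. -/
def derivEquiv : H1 ≃ₗᵢ[ℝ] H0 :=
  LinearIsometryEquiv.ofSurjective
    { toLinearMap := weakDeriv.codRestrict H0 integral_weakDeriv
      norm_map' := fun _ => rfl }
    (by
      intro g
      have : (g : L2T) ∈ Set.range weakDeriv := by rw [range_weakDeriv]; exact g.2
      obtain ⟨q, hq⟩ := this
      exact ⟨q, Subtype.ext hq⟩)

theorem coe_derivEquiv (q : H1) : (derivEquiv q : L2T) = weakDeriv q := rfl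

/-- The bounded bilinear map `(p, q) ↦ pq - ∫ pq`. -/
def mulMean : H1 →L[ℝ] H1 →L[ℝ] H0 :=
  (ContinuousLinearMap.compL ℝ H1 C(UnitAddCircle, ℝ) H0
    (meanProj ∘L ContinuousMap.toLp 2 volume ℝ)).comp
      ((ContinuousLinearMap.mul ℝ C(UnitAddCircle, ℝ)).bilinearComp toContinuous toContinuous)

theorem mulMean_apply (p q : H1) : mulMean p q =
    meanProj (ContinuousMap.toLp 2 volume ℝ (toContinuous p * toContinuous q)) := rfl

theorem mulMean_comm (p q : H1) : mulMean p q = mulMean q p := by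
  rw [mulMean_apply, mulMean_apply, mul_comm]

theorem norm_mulMean_le (p q : H1) : ‖mulMean p q‖ ≤ ‖toContinuous p‖ * ‖toContinuous q‖ := by
  rw [mulMean_apply]
  exact (norm_meanProj_le _).trans ((norm_toLp_le _).trans (norm_mul_le _ _))

theorem coeFn_mulMean (p q : H1) : ((mulMean p q : L2T) : UnitAddCircle → ℝ) =ᵐ[volume]
    fun x => toContinuous p x * toContinuous q x
      - ∫ t, toContinuous p t * toContinuous q t := by
  rw [mulMean_apply]
  have h := ContinuousMap.coeFn_toLp (p := 2) (𝕜 := ℝ) (volume : Measure UnitAddCircle)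
    (toContinuous p * toContinuous q)
  filter_upwards [coeFn_meanProj (ContinuousMap.toLp 2 volume ℝ (toContinuous p * toContinuous q)),
    h] with x h1 h2
  rw [h1, integral_congr_ae h, h2]
  simp

theorem norm_toL2_sq (q : H1) : ‖toL2 q‖ ^ 2 = ∫ x, toContinuous q x ^ 2 := by
  rw [← toLp_toContinuous, norm_toLp_sq]

theorem integrable_toContinuous_pow (v : H1) (n : ℕ) :
    Integrable (fun x => toContinuous v x ^ n) volume :=
  ((toContinuous v).continuous.pow n).integrable_of_hasCompactSupport
    (HasCompactSupport.of_compactSpace _)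

theorem norm_mulMean_self_sq (v : H1) :
    ‖mulMean v v‖ ^ 2 = (∫ x, toContinuous v x ^ 4) - ‖toL2 v‖ ^ 4 := by
  have h1 : ∫ x, (toContinuous v * toContinuous v) x ^ 2 = ∫ x, toContinuous v x ^ 4 :=
    integral_congr_ae (Filter.Eventually.of_forall fun x => by
      simp only [ContinuousMap.mul_apply]
      ring)
  have h2 : ∫ x, (toContinuous v * toContinuous v) x = ∫ x, toContinuous v x ^ 2 :=
    integral_congr_ae (Filter.Eventually.of_forall fun x => by
      simp only [ContinuousMap.mul_apply]
      ring)
  rw [mulMean_apply, norm_meanProj_sq, norm_toLp_sq, integral_congr_ae (ContinuousMap.coeFn_toLp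
    (p := 2) (𝕜 := ℝ) (volume : Measure UnitAddCircle) (toContinuous v * toContinuous v)),
    show ‖toL2 v‖ ^ 4 = (‖toL2 v‖ ^ 2) ^ 2 by ring, norm_toL2_sq, h1, h2]

/-- Pointwise `v⁴ ≤ v² ‖v'‖²` by the Sobolev bound; integrate. -/
theorem norm_mulMean_self_sq_le (v : H1) :
    ‖mulMean v v‖ ^ 2 ≤ ‖toL2 v‖ ^ 2 * ‖weakDeriv v‖ ^ 2 - ‖toL2 v‖ ^ 4 := by
  rw [norm_mulMean_self_sq]
  refine sub_le_sub_right ?_ _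
  rw [norm_toL2_sq, ← integral_mul_const]
  refine integral_mono (integrable_toContinuous_pow v 4)
    ((integrable_toContinuous_pow v 2).mul_const _) fun x => ?_
  have h1 : |toContinuous v x| ≤ ‖weakDeriv v‖ :=
    ((toContinuous v).norm_coe_le_norm x).trans (norm_toContinuous_le v)
  have h2 := sq_le_sq' (neg_le_of_abs_le h1) (le_of_abs_le h1)
  have h3 := mul_le_mul_of_nonneg_left h2 (sq_nonneg (toContinuous v x))
  refine le_trans (le_of_eq ?_) h3
  ring

/-- The mean of `v²` does not matter since `v'` has zero mean, and `3 v' v² = (v³)'` integrates to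
zero over a period. -/
theorem inner_derivEquiv_mulMean_self (v : H1) : inner ℝ (derivEquiv v) (mulMean v v) = 0 := by
  rw [mulMean_apply, inner_meanProj, coe_derivEquiv, L2.inner_def]
  have e : ∫ x, inner ℝ (weakDeriv v x)
      ((ContinuousMap.toLp 2 volume ℝ (toContinuous v * toContinuous v) : L2T) x)
      = ∫ x in (0 : ℝ)..1, weakDeriv v (x : UnitAddCircle) *
        toContinuous v (x : UnitAddCircle) ^ 2 := by
    have h := UnitAddCircle.intervalIntegral_preimage 0
      (fun x => weakDeriv v x * toContinuous v x ^ 2)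
    rw [zero_add] at h
    rw [h]
    refine integral_congr_ae ?_
    filter_upwards [ContinuousMap.coeFn_toLp (p := 2) (𝕜 := ℝ) volume
      (toContinuous v * toContinuous v)] with x hx
    rw [hx, ContinuousMap.mul_apply, sq]
    exact mul_comm _ _
  rw [e]
  have hac := absolutelyContinuousOnInterval_toContinuous v 0 1
  have h := ((hac.fun_mul hac).fun_mul hac).integral_deriv_eq_sub
  have e2 : ∫ x in (0 : ℝ)..1, deriv (fun x : ℝ => toContinuous v (x : UnitAddCircle) *
      toContinuous v (x : UnitAddCircle) * toContinuous v (x : UnitAddCircle)) x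
      = 3 * ∫ x in (0 : ℝ)..1, weakDeriv v (x : UnitAddCircle) *
        toContinuous v (x : UnitAddCircle) ^ 2 := by
    rw [← intervalIntegral.integral_const_mul]
    refine intervalIntegral.integral_congr_ae ?_
    filter_upwards [ae_hasDerivAt_toContinuous v] with x hx _
    rw [((hx.fun_mul hx).fun_mul hx).deriv]
    simp only [lift]
    ring
  have e3 : ((1 : ℝ) : UnitAddCircle) = ((0 : ℝ) : UnitAddCircle) := by
    simp
  rw [e2, e3, sub_self] at h
  linarith

/-! ### The Riccati map and a lower bound for its linearisation. -/

/-- The operator `w ↦ w' + sw - ∫ sw` from `𝓗₁` to `𝓗₀`. -/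
def riccatiLin (s : H1) : H1 →L[ℝ] H0 := (derivEquiv.toContinuousLinearEquiv : H1 →L[ℝ] H0) + mulMean s

theorem riccatiLin_apply (s w : H1) : riccatiLin s w = derivEquiv w + mulMean s w := rfl

/-- The nonlinear map `v ↦ -(v' + κ (v² - ∫ v²))`. -/
def riccati (κ : ℝ) (v : H1) : H0 := -(derivEquiv v + κ • mulMean v v)

theorem norm_riccati_sq (κ : ℝ) (v : H1) :
    ‖riccati κ v‖ ^ 2 = ‖weakDeriv v‖ ^ 2 + κ ^ 2 * ‖mulMean v v‖ ^ 2 := by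
  have h := real_inner_smul_right (derivEquiv v) (mulMean v v) κ
  rw [riccati, norm_neg, norm_add_sq_real, h, inner_derivEquiv_mulMean_self,
    norm_smul, mul_pow, Real.norm_eq_abs, sq_abs, derivEquiv.norm_map, norm_def]
  ring

theorem norm_le_norm_riccati (κ : ℝ) (v : H1) : ‖v‖ ≤ ‖riccati κ v‖ := by
  refine abs_le_of_sq_le_sq' ?_ (norm_nonneg _) |>.2
  rw [norm_riccati_sq, norm_def]
  linarith [mul_nonneg (sq_nonneg κ) (sq_nonneg ‖mulMean v v‖)]

/-- This is `v² - w² = (v + w)(v - w)`: differences of the nonlinear map are exactly values of the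
linear operator. -/
theorem riccati_sub (κ : ℝ) (v w : H1) :
    riccati κ v - riccati κ w = -riccatiLin (κ • (v + w)) (v - w) := by
  rw [riccatiLin_apply]
  simp only [riccati, map_sub, map_add, map_smul, add_apply,
    smul_apply, mulMean_comm w v]
  module

theorem ae_lift_riccatiLin (s w : H1) : ∀ᵐ x : ℝ, lift (riccatiLin s w : L2T) x =
    lift (weakDeriv w) x + toContinuous s (x : UnitAddCircle) * toContinuous w (x : UnitAddCircle)
      - ∫ t, toContinuous s t * toContinuous w t := by
  have h : ∀ᵐ x : UnitAddCircle, (riccatiLin s w : L2T) x = weakDeriv w x +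
      toContinuous s x * toContinuous w x - ∫ t, toContinuous s t * toContinuous w t := by
    rw [riccatiLin_apply, Submodule.coe_add, coe_derivEquiv]
    filter_upwards [Lp.coeFn_add (weakDeriv w) (mulMean s w : L2T), coeFn_mulMean s w] with x h1 h2
    rw [h1, Pi.add_apply, h2]
    ring
  exact ae_coe_iff.mpr h

/-- Quantitative injectivity of `w ↦ w' + sw - ∫ sw`, uniformly for `s` in a ball. -/
theorem norm_toContinuous_le_riccatiLin {R : ℝ} {s : H1} (hs : ‖s‖ ≤ R) (w : H1) :
    ‖toContinuous w‖ ≤ (Real.exp R ^ 2 + Real.exp R ^ 4) * ‖riccatiLin s w‖ := by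
  set E := Real.exp R with hE
  set f : L2T := ((riccatiLin s w : H0) : L2T) with hf
  change _ ≤ _ * ‖f‖
  set c : ℝ := ∫ t, toContinuous s t * toContinuous w t with hc
  set S : ℝ → ℝ := fun x => toContinuous s (x : UnitAddCircle) with hS
  set W : ℝ → ℝ := fun x => toContinuous w (x : UnitAddCircle) with hW
  have hE0 : 0 < E := Real.exp_pos R
  have hScont : Continuous S := (toContinuous s).continuous.comp (AddCircle.continuous_mk' 1)
  set P : ℝ → ℝ := fun x => ∫ t in (0 : ℝ)..x, S t with hP
  have hPd : ∀ x, HasDerivAt P (S x) x := fun x =>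
    (hScont.integral_hasStrictDerivAt 0 x).hasDerivAt
  -- Integrating factor: `w' + sw = f + c` becomes `(wp)' = (f + c) p`.
  set p : ℝ → ℝ := fun x => Real.exp (P x) with hp
  have hpd : ∀ x, HasDerivAt p (p x * S x) x := fun x => (hPd x).exp
  have hpcont : Continuous p := continuous_iff_continuousAt.mpr fun x => (hpd x).continuousAt
  have hpac : ∀ a b, AbsolutelyContinuousOnInterval p a b := fun a b => by
    refine ContDiffOn.absolutelyContinuousOnInterval (ContDiff.contDiffOn ?_)
    rw [contDiff_one_iff_deriv]
    refine ⟨fun x => (hpd x).differentiableAt, ?_⟩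
    rw [show deriv p = fun x => p x * S x from funext fun x => (hpd x).deriv]
    exact hpcont.mul hScont
  have hPle : ∀ x ∈ Set.Icc (0 : ℝ) 1, |P x| ≤ R := fun x hx => by
    have hb : ∀ t ∈ Set.uIoc 0 x, ‖S t‖ ≤ R := fun t _ =>
      ((toContinuous s).norm_coe_le_norm _).trans ((norm_toContinuous_le s).trans hs)
    have h := intervalIntegral.norm_integral_le_of_norm_le_const hb
    have hR : 0 ≤ R := (norm_nonneg s).trans hs
    refine h.trans ?_
    rw [sub_zero, abs_of_nonneg hx.1]
    nlinarith [hx.2]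
  have hple : ∀ x ∈ Set.Icc (0 : ℝ) 1, |p x| ≤ E := fun x hx => by
    rw [abs_of_pos (Real.exp_pos _)]
    exact Real.exp_le_exp.mpr (le_of_abs_le (hPle x hx))
  have hlep : ∀ x ∈ Set.Icc (0 : ℝ) 1, E⁻¹ ≤ p x := fun x hx => by
    rw [hE, ← Real.exp_neg]
    exact Real.exp_le_exp.mpr (neg_le_of_abs_le (hPle x hx))
  have hint : ∀ a b, W b * p b - W a * p a =
      (∫ x in a..b, lift f x * p x) + c * ∫ x in a..b, p x := fun a b => by
    rw [← ((absolutelyContinuousOnInterval_toContinuous w a b).fun_mul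
      (hpac a b)).integral_deriv_eq_sub, ← intervalIntegral.integral_const_mul,
      ← intervalIntegral.integral_add
        ((intervalIntegrable_lift_of_le f a b).mul_continuousOn hpcont.continuousOn)
        ((hpcont.const_mul c).intervalIntegrable a b)]
    refine intervalIntegral.integral_congr_ae ?_
    filter_upwards [ae_hasDerivAt_toContinuous w, ae_lift_riccatiLin s w] with x h1 h2 _
    rw [(h1.fun_mul (hpd x)).deriv, h2]
    simp only [hS]
    ring
  have hper : ((1 : ℝ) : UnitAddCircle) = ((0 : ℝ) : UnitAddCircle) := by simp
  have hP0 : P 0 = 0 := intervalIntegral.integral_same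
  have hP1 : P 1 = 0 := by
    have h := UnitAddCircle.intervalIntegral_preimage 0 (toContinuous s)
    rw [zero_add] at h
    rw [← integral_toContinuousₗ s]
    exact h
  -- Over a full period the boundary terms cancel, since `p 0 = p 1 = 1`. This controls the unknown
  -- constant `c` by `f`, as `p` is bounded away from zero.
  have hci : (∫ x in (0 : ℝ)..1, lift f x * p x) + c * ∫ x in (0 : ℝ)..1, p x = 0 := by
    rw [← hint 0 1]
    simp only [hp, hP0, hP1, hW, hper]
    ring
  have hpint : E⁻¹ ≤ ∫ x in (0 : ℝ)..1, p x := by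
    have h := intervalIntegral.integral_mono_on zero_le_one
      (intervalIntegrable_const (c := E⁻¹) (μ := volume)) (hpcont.intervalIntegrable 0 1) hlep
    simpa using h
  have hcle : |c| ≤ ‖f‖ * E ^ 2 := by
    have h1 := abs_integral_lift_mul_le f hpcont hple (a := 0) (b := 1) (by simp) (by simp)
    rw [eq_neg_of_add_eq_zero_left hci, abs_neg, abs_mul] at h1
    have h2 : |c| * E⁻¹ ≤ ‖f‖ * E := by
      refine le_trans (mul_le_mul_of_nonneg_left (hpint.trans (le_abs_self _)) (abs_nonneg c)) h1
    calc |c| = |c| * E⁻¹ * E := by field_simp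
      _ ≤ ‖f‖ * E * E := by gcongr
      _ = ‖f‖ * E ^ 2 := by ring
  rw [ContinuousMap.norm_le _ (by positivity)]
  intro x
  -- Starting the integration at a zero of `w` removes the other boundary term.
  obtain ⟨z, hz, hz0⟩ := exists_toContinuousₗ_eq_zero w
  obtain ⟨y, hy, rfl⟩ := exists_mem_Icc_coe_eq x
  have hY := hint z y
  have hWz : W z = 0 := hz0
  rw [hWz, zero_mul, sub_zero] at hY
  have h1 := abs_integral_lift_mul_le f hpcont hple hz hy
  have h2 : |∫ x in z..y, p x| ≤ E := by
    have hb : ∀ t ∈ Set.uIoc z y, ‖p t‖ ≤ E := fun t ht => by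
      rw [Set.uIoc] at ht
      exact hple t ⟨(le_min hz.1 hy.1).trans ht.1.le, ht.2.trans (max_le hz.2 hy.2)⟩
    refine (intervalIntegral.norm_integral_le_of_norm_le_const hb).trans ?_
    have : |y - z| ≤ 1 := abs_le.mpr ⟨by linarith [hz.2, hy.1], by linarith [hz.1, hy.2]⟩
    nlinarith
  have h3 : |W y| * E⁻¹ ≤ ‖f‖ * E + ‖f‖ * E ^ 2 * E := by
    calc |W y| * E⁻¹ ≤ |W y| * p y := mul_le_mul_of_nonneg_left (hlep y hy) (abs_nonneg _)
      _ = |W y * p y| := by rw [abs_mul, abs_of_pos (Real.exp_pos (P y))]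
      _ ≤ |∫ x in z..y, lift f x * p x| + |c| * |∫ x in z..y, p x| := by
        rw [hY, ← abs_mul]
        exact abs_add_le _ _
      _ ≤ _ := by gcongr
  calc ‖toContinuous w (y : UnitAddCircle)‖ = |W y| * E⁻¹ * E := by
        rw [Real.norm_eq_abs, mul_assoc, inv_mul_cancel₀ hE0.ne', mul_one]
    _ ≤ (‖f‖ * E + ‖f‖ * E ^ 2 * E) * E := by gcongr
    _ = _ := by ring

/-- The sup-norm bound controls `sw - ∫ sw`, and then `w' = L_s w - (sw - ∫ sw)` controls the full
norm of `𝓗₁`. -/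
theorem exists_norm_le_riccatiLin (R : ℝ) :
    ∃ C : ℝ, 0 < C ∧ ∀ s w : H1, ‖s‖ ≤ R → ‖w‖ ≤ C * ‖riccatiLin s w‖ := by
  refine ⟨1 + |R| * (Real.exp R ^ 2 + Real.exp R ^ 4), by positivity, fun s w hs => ?_⟩
  have h1 : derivEquiv w = riccatiLin s w - mulMean s w := by
    rw [riccatiLin_apply, add_sub_cancel_right]
  calc ‖w‖ = ‖derivEquiv w‖ := (derivEquiv.norm_map w).symm
    _ ≤ ‖riccatiLin s w‖ + ‖mulMean s w‖ := by rw [h1]; exact norm_sub_le _ _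
    _ ≤ ‖riccatiLin s w‖ + |R| * ((Real.exp R ^ 2 + Real.exp R ^ 4) * ‖riccatiLin s w‖) := by
      gcongr
      refine (norm_mulMean_le s w).trans (mul_le_mul ?_ (norm_toContinuous_le_riccatiLin hs w)
        (norm_nonneg _) (abs_nonneg _))
      exact (norm_toContinuous_le s).trans (hs.trans (le_abs_self R))
    _ = _ := by ring

end H1

/-! ### Invertibility of the linearisation. -/

/-- The method of continuity: if `A + tB` is bounded below uniformly in `t ∈ [0, 1]` and `A` is an
isomorphism of Banach spaces, then so is `A + B`. -/
theorem exists_equiv_add_of_bounded_below {E F : Type*} [NormedAddCommGroup E] [NormedSpace ℝ E]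
    [CompleteSpace E] [NormedAddCommGroup F] [NormedSpace ℝ F] (A : E ≃L[ℝ] F) (B : E →L[ℝ] F)
    (C : ℝ) (h : ∀ t ∈ Set.Icc (0 : ℝ) 1, ∀ x, ‖x‖ ≤ C * ‖A x + t • B x‖) :
    ∃ e : E ≃L[ℝ] F, (e : E →L[ℝ] F) = (A : E →L[ℝ] F) + B := by
  -- The inverses along the path all have norm at most `|C|`, so steps of length `1/n` keep each
  -- perturbation within reach of a Neumann series.
  obtain ⟨n, hn⟩ := exists_nat_gt (|C| * ‖B‖)
  have hn0 : (0 : ℝ) < n := lt_of_le_of_lt (by positivity) hn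
  have key : ∀ k : ℕ, k ≤ n → ∃ e : E ≃L[ℝ] F,
      (e : E →L[ℝ] F) = (A : E →L[ℝ] F) + ((k : ℝ) / n) • B := by
    intro k
    induction k with
    | zero => exact fun _ => ⟨A, by simp⟩
    | succ k ih =>
      intro hk
      obtain ⟨e, he⟩ := ih (by omega)
      have hkn : (k : ℝ) / n ∈ Set.Icc (0 : ℝ) 1 :=
        ⟨by positivity, (div_le_one hn0).mpr (by exact_mod_cast (by omega : k ≤ n))⟩
      have hsymm : ∀ y, ‖e.symm y‖ ≤ |C| * ‖y‖ := fun y => by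
        have h1 := h _ hkn (e.symm y)
        have h2 : A (e.symm y) + ((k : ℝ) / n) • B (e.symm y) = y := by
          have := congrArg (fun T : E →L[ℝ] F => T (e.symm y)) he
          simpa using this.symm
        rw [h2] at h1
        exact h1.trans (mul_le_mul_of_nonneg_right (le_abs_self C) (norm_nonneg _))
      -- Chosen so that `e ∘ (1 - K) = e + B/n`, the next operator on the path.
      set K : E →L[ℝ] E := -((e.symm : F →L[ℝ] E) ∘L ((n : ℝ)⁻¹ • B)) with hK
      have hK1 : ‖K‖ < 1 := by
        refine lt_of_le_of_lt (ContinuousLinearMap.opNorm_le_bound _ (by positivity)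
          (M := |C| * ((n : ℝ)⁻¹ * ‖B‖)) fun x => ?_) ?_
        · have : K x = -e.symm ((n : ℝ)⁻¹ • B x) := rfl
          rw [this, norm_neg]
          refine (hsymm _).trans ?_
          rw [norm_smul, Real.norm_of_nonneg (by positivity), mul_assoc, mul_assoc]
          gcongr
          exact B.le_opNorm x
        · rw [mul_left_comm, inv_mul_lt_iff₀ hn0, mul_one]
          exact hn
      refine ⟨(ContinuousLinearEquiv.unitsEquiv ℝ E (Units.oneSub K hK1)).trans e, ?_⟩
      ext x
      have h3 : e x = A x + ((k : ℝ) / n) • B x :=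
        congrArg (fun T : E →L[ℝ] F => T x) he
      have h4 : ContinuousLinearEquiv.unitsEquiv ℝ E (Units.oneSub K hK1) x
          = x + e.symm ((n : ℝ)⁻¹ • B x) := by
        simp [hK]
      change e (ContinuousLinearEquiv.unitsEquiv ℝ E (Units.oneSub K hK1) x)
        = A x + (((k + 1 : ℕ) : ℝ) / n) • B x
      rw [h4, map_add, e.apply_symm_apply, h3, add_assoc, ← add_smul]
      congr 2
      push_cast
      ring
  obtain ⟨e, he⟩ := key n le_rfl
  exact ⟨e, by rw [he, div_self hn0.ne', one_smul]⟩

namespace H1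

/-- The path from `w ↦ w'` to `L_s` consists of the operators `L_{ts}`, and `‖ts‖ ≤ ‖s‖`, so a
single constant serves all of them. -/
theorem exists_equiv_riccatiLin (s : H1) :
    ∃ e : H1 ≃L[ℝ] H0, (e : H1 →L[ℝ] H0) = riccatiLin s := by
  obtain ⟨C, -, hC⟩ := exists_norm_le_riccatiLin ‖s‖
  refine exists_equiv_add_of_bounded_below derivEquiv.toContinuousLinearEquiv (mulMean s) C
    fun t ht x => ?_
  have h := hC (t • s) x (by
    rw [norm_smul, Real.norm_of_nonneg ht.1]
    exact mul_le_of_le_one_left (norm_nonneg _) ht.2)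
  rwa [riccatiLin_apply, map_smul, smul_apply] at h

/-! ### The Riccati map is a real analytic isomorphism. -/

theorem analyticAt_riccati (κ : ℝ) (v : H1) : AnalyticAt ℝ (riccati κ) v := by
  have h1 : AnalyticAt ℝ (fun v : H1 => derivEquiv v) v :=
    (derivEquiv.toContinuousLinearEquiv : H1 →L[ℝ] H0).analyticAt v
  have h2 : AnalyticAt ℝ (fun v : H1 => mulMean v v) v :=
    (ContinuousLinearMap.analyticAt_bilinear (E := H1) (F := H1) (G := H0) mulMean (v, v)).comp
      (g := fun p : H1 × H1 => mulMean p.1 p.2) (f := fun v : H1 => (v, v))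
      (analyticAt_id.prod analyticAt_id)
  exact (h1.add ((analyticAt_const (v := κ)).smul h2)).neg

theorem hasFDerivAt_riccati (κ : ℝ) (v : H1) :
    HasFDerivAt (riccati κ) (-riccatiLin ((2 * κ) • v)) v := by
  have h1 : HasFDerivAt (fun v : H1 => derivEquiv v)
      (derivEquiv.toContinuousLinearEquiv : H1 →L[ℝ] H0) v :=
    (derivEquiv.toContinuousLinearEquiv : H1 →L[ℝ] H0).hasFDerivAt
  have h2 := (mulMean.hasFDerivAt (x := v)).clm_apply (hasFDerivAt_id v)
  refine (h1.add (h2.const_smul κ)).neg.congr_fderiv ?_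
  ext1 w
  simp only [riccatiLin, neg_apply, add_apply, smul_apply, map_smul, id_eq,
    ContinuousLinearMap.comp_apply, ContinuousLinearMap.flip_apply,
    ContinuousLinearMap.id_apply, mulMean_comm w v]
  module

theorem exists_equiv_hasStrictFDerivAt_riccati (κ : ℝ) (v : H1) :
    ∃ e : H1 ≃L[ℝ] H0, HasStrictFDerivAt (riccati κ) (e : H1 →L[ℝ] H0) v := by
  obtain ⟨e, he⟩ := exists_equiv_riccatiLin ((2 * κ) • v)
  refine ⟨e.trans (ContinuousLinearEquiv.neg ℝ), ?_⟩
  have h := (analyticAt_riccati κ v).hasStrictFDerivAt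
  rw [(hasFDerivAt_riccati κ v).fderiv, ← he] at h
  exact h

theorem norm_sub_le_riccati_sub (κ R : ℝ) : ∃ C : ℝ, 0 < C ∧ ∀ v w : H1, ‖v‖ ≤ R → ‖w‖ ≤ R →
    ‖v - w‖ ≤ C * ‖riccati κ v - riccati κ w‖ := by
  obtain ⟨C, hC0, hC⟩ := exists_norm_le_riccatiLin (|κ| * (R + R))
  refine ⟨C, hC0, fun v w hv hw => ?_⟩
  rw [riccati_sub, norm_neg]
  refine hC _ _ ?_
  rw [norm_smul, Real.norm_eq_abs]
  gcongr
  exact (norm_add_le _ _).trans (add_le_add hv hw)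

theorem riccati_injective (κ : ℝ) : Function.Injective (riccati κ) := by
  intro v w h
  obtain ⟨C, -, hC⟩ := norm_sub_le_riccati_sub κ (max ‖v‖ ‖w‖)
  have := hC v w (le_max_left _ _) (le_max_right _ _)
  rw [h, sub_self, norm_zero, mul_zero] at this
  exact sub_eq_zero.mp (norm_le_zero_iff.mp this)

theorem isOpen_range_riccati (κ : ℝ) : IsOpen (Set.range (riccati κ)) := by
  rw [isOpen_iff_mem_nhds]
  rintro _ ⟨v, rfl⟩
  obtain ⟨e, he⟩ := exists_equiv_hasStrictFDerivAt_riccati κ v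
  rw [← he.map_nhds_eq_of_equiv]
  exact Filter.range_mem_map

/-- Preimages of a convergent sequence are bounded by coercivity, hence Cauchy by the Lipschitz
bound for the inverse on that ball; continuity identifies the image of their limit. -/
theorem isClosed_range_riccati (κ : ℝ) : IsClosed (Set.range (riccati κ)) := by
  refine IsSeqClosed.isClosed fun y F hy hF => ?_
  choose v hv using hy
  obtain ⟨R, hR⟩ := hF.norm.bddAbove_range
  have hvR : ∀ n, ‖v n‖ ≤ R := fun n =>
    (norm_le_norm_riccati κ (v n)).trans (by rw [hv]; exact hR ⟨n, rfl⟩)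
  obtain ⟨C, hC0, hC⟩ := norm_sub_le_riccati_sub κ R
  have hcau : CauchySeq v := by
    rw [Metric.cauchySeq_iff]
    intro ε hε
    obtain ⟨N, hN⟩ := Metric.cauchySeq_iff.mp hF.cauchySeq (ε / C) (by positivity)
    refine ⟨N, fun k hk l hl => ?_⟩
    have h1 := hN k hk l hl
    have h2 := hC (v k) (v l) (hvR k) (hvR l)
    rw [hv, hv, ← dist_eq_norm, ← dist_eq_norm] at h2
    refine lt_of_le_of_lt h2 ?_
    rwa [lt_div_iff₀ hC0, mul_comm] at h1
  obtain ⟨u, hu⟩ := cauchySeq_tendsto_of_complete hcau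
  refine ⟨u, tendsto_nhds_unique ?_ hF⟩
  have := (analyticAt_riccati κ u).continuousAt.tendsto.comp hu
  exact this.congr hv

theorem riccati_bijective (κ : ℝ) : Function.Bijective (riccati κ) :=
  ⟨riccati_injective κ, Set.range_eq_univ.mp <|
    (isClopen_iff.mp ⟨isClosed_range_riccati κ, isOpen_range_riccati κ⟩).resolve_left
      (Set.range_nonempty _).ne_empty⟩

/-- The nonlinear map `v ↦ -(v' + κ (v² - ∫ v²))` as a bijection of `𝓗₁` onto `𝓗₀`. -/
def riccatiEquiv (κ : ℝ) : H1 ≃ H0 := Equiv.ofBijective (riccati κ) (riccati_bijective κ)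

/-- Global injectivity makes the inverse agree near `F` with the local analytic inverse. -/
theorem analyticAt_riccatiEquiv_symm (κ : ℝ) (F : H0) :
    AnalyticAt ℝ (riccatiEquiv κ).symm F := by
  obtain ⟨v, rfl⟩ := (riccatiEquiv κ).surjective F
  obtain ⟨e, he⟩ := exists_equiv_hasStrictFDerivAt_riccati κ v
  have h : AnalyticAt ℝ (he.toOpenPartialHomeomorph (riccati κ)).symm (riccati κ v) :=
    (he.toOpenPartialHomeomorph (riccati κ)).analyticAt_symm'
      he.mem_toOpenPartialHomeomorph_source (analyticAt_riccati κ v) he.hasFDerivAt.fderiv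
  refine h.congr ?_
  filter_upwards [(he.toOpenPartialHomeomorph (riccati κ)).open_target.mem_nhds
    he.image_mem_toOpenPartialHomeomorph_target] with y hy
  rw [Equiv.eq_symm_apply]
  exact (he.toOpenPartialHomeomorph (riccati κ)).right_inv hy

/-- Scaling by `2` on `𝓗₁`. -/
def doubling : H1 ≃L[ℝ] H1 := ContinuousLinearEquiv.smulLeft (Units.mk0 (2 : ℝ) two_ne_zero)

/-- The map `q ↦ ℰ₁` as a bijection of `𝓗₁` onto `𝓗₀`. -/
def ricciEquiv (m : ℕ) : H1 ≃ H0 := doubling.toEquiv.trans (riccatiEquiv (1 / m))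

theorem analyticOnNhd_ricciEquiv (m : ℕ) : AnalyticOnNhd ℝ (ricciEquiv m) Set.univ :=
  fun q _ => (analyticAt_riccati (1 / m) (doubling q)).comp
    ((doubling : H1 →L[ℝ] H1).analyticAt q)

theorem analyticOnNhd_ricciEquiv_symm (m : ℕ) : AnalyticOnNhd ℝ (ricciEquiv m).symm Set.univ :=
  fun F _ => ((doubling.symm : H1 →L[ℝ] H1).analyticAt _).comp
    (analyticAt_riccatiEquiv_symm (1 / m) F)

/-! ### Translation to the Ricci eigenvalue. -/

theorem integral_sq (v : H1) : ∫ x, toL2 v x ^ 2 = ‖toL2 v‖ ^ 2 := by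
  rw [norm_toL2_sq]
  refine integral_congr_ae ?_
  filter_upwards [coeFn_toContinuous v] with x hx
  rw [hx]

theorem coeFn_ricciEquiv (m : ℕ) (q : H1) :
    ((ricciEquiv m q : L2T) : UnitAddCircle → ℝ) =ᵐ[volume] ricciNonconst m q := by
  set v := (2 : ℝ) • q with hv
  have e : (ricciEquiv m q : L2T) = -(weakDeriv v + (1 / (m : ℝ)) • (mulMean v v : L2T)) := rfl
  rw [e]
  filter_upwards [Lp.coeFn_neg (weakDeriv v + (1 / (m : ℝ)) • (mulMean v v : L2T)),
    Lp.coeFn_add (weakDeriv v) ((1 / (m : ℝ)) • (mulMean v v : L2T)),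
    Lp.coeFn_smul (1 / (m : ℝ)) (mulMean v v : L2T), coeFn_mulMean v v, coeFn_toContinuous v]
    with x h1 h2 h3 h4 h5
  rw [h1, Pi.neg_apply, h2, Pi.add_apply, h3, Pi.smul_apply, h4, ricciNonconst, ← hv, h5,
    integral_sq, norm_toL2_sq, smul_eq_mul]
  simp only [← sq]
  ring

theorem ricciConst_eq (m : ℕ) (q : H1) :
    ricciConst m q = -(1 / (m : ℝ)) * ‖toL2 ((2 : ℝ) • q)‖ ^ 2 := by
  set v := (2 : ℝ) • q with hv
  have h : ∫ x, ricciEigenvalue m q x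
      = ∫ x, ((ricciEquiv m q : L2T) x - (1 / (m : ℝ)) * ‖toL2 v‖ ^ 2) := by
    refine integral_congr_ae ?_
    filter_upwards [coeFn_ricciEquiv m q] with x hx
    rw [hx, ricciNonconst, ricciEigenvalue, integral_sq]
    ring
  rw [ricciConst, h, integral_sub ((Lp.memLp _).integrable (by norm_num)) (integrable_const _),
    mem_H0.mp (ricciEquiv m q).2]
  simp

theorem ricciEigenvalue_eq (m : ℕ) (q : H1) (x : UnitAddCircle) :
    ricciEigenvalue m q x = ricciConst m q + ricciNonconst m q x := by
  rw [ricciConst_eq, ricciEigenvalue, ricciNonconst, integral_sq]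
  ring

/-- Integrating the equation isolates `e`, because `F` has zero mean; subtracting it leaves `ℰ₁ =
F`. -/
theorem ae_ricciEigenvalue_eq_iff (m : ℕ) (q : H1) (e : ℝ) (F : H0) :
    (∀ᵐ x : UnitAddCircle, ricciEigenvalue m q x = e + (F : L2T) x) ↔
      ricciConst m q = e ∧ ricciEquiv m q = F := by
  constructor
  · intro h
    have he : ricciConst m q = e := by
      rw [ricciConst, integral_congr_ae h, integral_add (by simp)
        ((Lp.memLp _).integrable (by norm_num)), mem_H0.mp F.2]
      simp
    refine ⟨he, Subtype.ext (Lp.ext ?_)⟩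
    filter_upwards [h, coeFn_ricciEquiv m q] with x h1 h2
    rw [ricciEigenvalue_eq, he] at h1
    rw [h2]
    linarith
  · rintro ⟨rfl, rfl⟩
    filter_upwards [coeFn_ricciEquiv m q] with x hx
    rw [hx, ricciEigenvalue_eq]

theorem norm_ricciEquiv_sq (m : ℕ) (q : H1) : ‖ricciEquiv m q‖ ^ 2 =
    ‖weakDeriv ((2 : ℝ) • q)‖ ^ 2 + (1 / (m : ℝ)) ^ 2 * ‖mulMean ((2 : ℝ) • q) ((2 : ℝ) • q)‖ ^ 2 :=
  norm_riccati_sq _ _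

/-! ### Gaussian curvature of the rotational metric. -/

theorem profile_one_eq (r₀ : ℝ) (q : H1) : profile 1 r₀ q = fun x =>
    r₀ * Real.exp (∫ t in (0 : ℝ)..x, toContinuous ((2 : ℝ) • q) (t : UnitAddCircle)) := by
  funext x
  rw [profile]
  have h : ∫ t in (0 : ℝ)..x, lift (toL2 q) t
      = ∫ t in (0 : ℝ)..x, toContinuous q (t : UnitAddCircle) := by
    refine intervalIntegral.integral_congr_ae ?_
    filter_upwards [ae_coe_iff.mpr (coeFn_toContinuous q)] with t ht _
    exact ht
  rw [h, map_smul, ← intervalIntegral.integral_const_mul]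
  simp

theorem rotationalCurvature_profile {r₀ : ℝ} (hr₀ : 0 < r₀) (q : H1) :
    ∀ᵐ x : ℝ, ∀ y : ℝ, rotationalCurvature (profile 1 r₀ q) x y
      = ricciEigenvalue 1 q (x : UnitAddCircle) := by
  set v := (2 : ℝ) • q with hv
  set V : ℝ → ℝ := fun x => toContinuous v (x : UnitAddCircle) with hV
  set r := profile 1 r₀ q with hr
  have hVcont : Continuous V := (toContinuous v).continuous.comp (AddCircle.continuous_mk' 1)
  have hr' : r = fun x => r₀ * Real.exp (∫ t in (0 : ℝ)..x, V t) := profile_one_eq r₀ q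
  have hrpos : ∀ x, 0 < r x := fun x => by
    rw [hr']
    positivity
  have hrd : ∀ x, HasDerivAt r (r x * V x) x := fun x => by
    have h := ((hVcont.integral_hasStrictDerivAt 0 x).hasDerivAt.exp).const_mul r₀
    rw [hr']
    simpa only [mul_assoc] using h
  have hsqrt : ∀ x, √(1 * r x ^ 2) = r x := fun x => by
    rw [one_mul, Real.sqrt_sq (hrpos x).le]
  -- The inner derivative exists everywhere, since `r` is the exponential of a primitive of a
  -- continuous function. Only the outer one, which involves `v'`, is restricted to almost every
  -- point.
  have hinner : (fun s => deriv (fun s' => r s' ^ 2) s / √(1 * r s ^ 2))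
      = fun s => 2 * (r s * V s) := by
    funext s
    rw [hsqrt, ((hrd s).fun_pow 2).deriv]
    have := (hrpos s).ne'
    field_simp
    push_cast
    ring
  filter_upwards [ae_hasDerivAt_toContinuous v, ae_coe_iff.mpr (coeFn_toContinuous v)]
    with x h1 h2 y
  have hx := (((hrd x).fun_mul h1).const_mul 2).deriv
  have hx' : deriv (fun s => 2 * (r s * V s)) x
      = 2 * (r x * V x * V x + r x * lift (weakDeriv v) x) := hx
  rw [rotationalCurvature, gaussianCurvature, hinner]
  simp only [hsqrt, hx', deriv_const, zero_div, add_zero, ricciEigenvalue, ← hv, h2]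
  have := (hrpos x).ne'
  simp only [lift, hV]
  field_simp
  push_cast
  ring

end H1

end PerturbedTorus

end

/-! ### The corollary. -/

theorem corollary2p5 (m : ℕ) (hm : 1 ≤ m) :
    ∃ Φ : PerturbedTorus.H1 ≃ PerturbedTorus.H0,
      -- `Φ` is the map `q ↦ ℰ₁`
      (∀ q : PerturbedTorus.H1,
        ((Φ q : PerturbedTorus.L2T) : UnitAddCircle → ℝ) =ᵐ[volume]
          PerturbedTorus.ricciNonconst m q) ∧
      -- it is a real analytic isomorphism
      AnalyticOnNhd ℝ (Φ : PerturbedTorus.H1 → PerturbedTorus.H0) Set.univ ∧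
      AnalyticOnNhd ℝ (Φ.symm : PerturbedTorus.H0 → PerturbedTorus.H1) Set.univ ∧
      -- two-sided estimates, with `v = 2q` and `L²`-norms throughout
      (∀ q : PerturbedTorus.H1, ∀ v : PerturbedTorus.H1, v = (2 : ℝ) • q →
        ‖PerturbedTorus.H1.weakDeriv v‖ ^ 2 ≤ ‖Φ q‖ ^ 2 ∧
        ‖Φ q‖ ^ 2 ≤ ‖PerturbedTorus.H1.weakDeriv v‖ ^ 2
          + ‖PerturbedTorus.H1.toL2 v‖ ^ 2 * ‖PerturbedTorus.H1.weakDeriv v‖ ^ 2 / (m : ℝ) ^ 2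
          - ‖PerturbedTorus.H1.toL2 v‖ ^ 4 / (m : ℝ) ^ 2) ∧
      -- the decomposition `ℰ = ℰ₀ + ℰ₁` with `ℰ₀ = -(1/m) ∫ v² ≤ 0`
      (∀ q : PerturbedTorus.H1,
        PerturbedTorus.ricciConst m q
          = -(1 / (m : ℝ)) * ‖PerturbedTorus.H1.toL2 ((2 : ℝ) • q)‖ ^ 2 ∧
        ∀ x, PerturbedTorus.ricciEigenvalue m q x
          = PerturbedTorus.ricciConst m q + PerturbedTorus.ricciNonconst m q x) ∧
      -- `ℰ₀` is determined by `ℰ₁`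
      (∃ κ : PerturbedTorus.H0 → ℝ,
        ∀ q : PerturbedTorus.H1, PerturbedTorus.ricciConst m q = κ (Φ q)) ∧
      (∀ F : PerturbedTorus.H0, ∃! p : PerturbedTorus.H1 × ℝ,
        ∀ᵐ x : UnitAddCircle, PerturbedTorus.ricciEigenvalue m p.1 x
          = p.2 + (F : PerturbedTorus.L2T) x) ∧
      -- for `m = 1`: prescribed non-constant part of the Gaussian curvature
      (m = 1 → ∀ r₀ : ℝ, 0 < r₀ → ∀ F : PerturbedTorus.H0, ∃! p : (ℝ → ℝ) × ℝ,
        (∃ q : PerturbedTorus.H1, p.1 = PerturbedTorus.profile m r₀ q) ∧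
        ∀ᵐ x : ℝ, ∀ y : ℝ, PerturbedTorus.rotationalCurvature p.1 x y
          = p.2 + PerturbedTorus.lift (F : PerturbedTorus.L2T) x) := by
  refine ⟨PerturbedTorus.H1.ricciEquiv m, PerturbedTorus.H1.coeFn_ricciEquiv m,
    PerturbedTorus.H1.analyticOnNhd_ricciEquiv m, PerturbedTorus.H1.analyticOnNhd_ricciEquiv_symm m,
    ?_, fun q => ⟨PerturbedTorus.H1.ricciConst_eq m q, PerturbedTorus.H1.ricciEigenvalue_eq m q⟩,
    ⟨fun F => PerturbedTorus.ricciConst m ((PerturbedTorus.H1.ricciEquiv m).symm F), fun q => by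
      simp only [Equiv.symm_apply_apply]⟩, fun F => ?_, ?_⟩
  · rintro q v rfl
    rw [PerturbedTorus.H1.norm_ricciEquiv_sq]
    refine ⟨le_add_of_nonneg_right (by positivity), ?_⟩
    have h := mul_le_mul_of_nonneg_left (PerturbedTorus.H1.norm_mulMean_self_sq_le ((2 : ℝ) • q))
      (sq_nonneg (1 / (m : ℝ)))
    refine (add_le_add_right h _).trans (le_of_eq ?_)
    ring
  · refine ⟨((PerturbedTorus.H1.ricciEquiv m).symm F,
      PerturbedTorus.ricciConst m ((PerturbedTorus.H1.ricciEquiv m).symm F)), ?_, ?_⟩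
    · exact (PerturbedTorus.H1.ae_ricciEigenvalue_eq_iff m _ _ F).mpr
        ⟨rfl, Equiv.apply_symm_apply _ F⟩
    · rintro ⟨q, e⟩ h
      obtain ⟨rfl, rfl⟩ := (PerturbedTorus.H1.ae_ricciEigenvalue_eq_iff m q e F).mp h
      rw [Equiv.symm_apply_apply]
  · rintro rfl r₀ hr₀ F
    -- The curvature equation determines `q` itself, so uniqueness of the profile does not need `q`
    -- to be recovered from `r`.
    have key : ∀ (q : PerturbedTorus.H1) (e : ℝ), (∀ᵐ x : ℝ, ∀ y : ℝ,
        PerturbedTorus.rotationalCurvature (PerturbedTorus.profile 1 r₀ q) x y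
          = e + PerturbedTorus.lift (F : PerturbedTorus.L2T) x) ↔
        PerturbedTorus.ricciConst 1 q = e ∧ PerturbedTorus.H1.ricciEquiv 1 q = F := by
      intro q e
      rw [← PerturbedTorus.H1.ae_ricciEigenvalue_eq_iff, ← PerturbedTorus.ae_coe_iff]
      refine Filter.eventually_congr ?_
      filter_upwards [PerturbedTorus.H1.rotationalCurvature_profile hr₀ q] with x hx
      simp only [hx, forall_const, PerturbedTorus.lift]
    refine ⟨(PerturbedTorus.profile 1 r₀ ((PerturbedTorus.H1.ricciEquiv 1).symm F),
      PerturbedTorus.ricciConst 1 ((PerturbedTorus.H1.ricciEquiv 1).symm F)), ⟨⟨_, rfl⟩, ?_⟩, ?_⟩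
    · exact (key _ _).mpr ⟨rfl, Equiv.apply_symm_apply _ F⟩
    · rintro ⟨r, e⟩ ⟨⟨q, hq⟩, h⟩
      dsimp only at hq h
      subst hq
      obtain ⟨rfl, hF⟩ := (key q e).mp h
      rw [← hF, Equiv.symm_apply_apply]
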